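/- Let $n\in\mathbb{N}$, $n\ge 1$, $\alpha>0$, and for $f\in L^2(\mathbb{R}^n)$ and $t\ge 0$ let $$e^{-t(-\Delta)^{\alpha}}f=\mathcal{F}^{-1}\bigl(e^{-t|\xi|^{2\alpha}}\,\mathcal{F}f(\xi)\bigr),\qquad \mathcal{F}f(\xi)=\int_{\mathbb{R}^n}e^{-ix\cdot\xi}f(x)\,dx,$$ where $\mathcal{F}$ is extended to $L^2(\mathbb{R}^n)$ by Plancherel's theorem. Let $(q,p,2)$ be $\frac{n}{2\alpha}$-admissible, that is, $2\le p\le\infty$ and $$\frac1q=\frac{n}{2\alpha}\Bigl(\frac12-\frac1p\Bigr),$$ where $\frac1\infty=0$ and $q=\infty$ is allowed. Suppose that $q\ge 2$ and that $(q,p,\frac{n}{2\alpha})\ne(2,\infty,1)$. Then there is a constant $C>0$, depending only on $n,\alpha,q,p$, such that $$\|e^{-t(-\Delta)^{\alpha}}f\|_{L^q_t(I;L^p_x(\mathbb{R}^n))}\le C\,\|f\|_{L^2(\mathbb{R}^n)}$$ for every $f\in L^2(\mathbb{R}^n)$ and for $I=[0,\infty)$ as well as $I=[0,T]$ for every $0<T<\infty$.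 Here $\|u\|_{L^q_t(I;L^p_x)}$ is the $L^q(I)$ norm of the (measurable) function $t\mapsto\|u(t,\cdot)\|_{L^p(\mathbb{R}^n)}$. In particular, if $n>2\alpha$, the endpoint $q=2$, $p=\frac{2n}{n-2\alpha}$ is included. -/

import Mathlib

open MeasureTheory Set FourierTransform
open scoped ENNReal NNReal

noncomputable section

/-- Euclidean space `ℝⁿ`. -/
abbrev Rn (n : ℕ) : Type := EuclideanSpace ℝ (Fin n)

/-- `L²(ℝⁿ)`, complex-valued; it contains the real-valued functions. -/
abbrev L2Rn (n : ℕ) : Type := Lp ℂ 2 (volume : Measure (Rn n))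

/-- The symbol of `e^{-t(-Δ)^α}`. Mathlib's Fourier transform is
`𝓕 f ξ = ∫ e^{-2πi⟨x, ξ⟩} f x dx`, for which `-Δ` has the symbol `|2πξ|²`; hence `(-Δ)^α` has the
symbol `|2πξ|^{2α}` (which is `|ξ|^{2α}` in the angular frequency variable). -/
def heatSymbol {n : ℕ} (α t : ℝ) (ξ : Rn n) : ℝ :=
  Real.exp (-t * (2 * Real.pi * ‖ξ‖) ^ (2 * α))

theorem memLp_heatSymbol_mul {n : ℕ} (α : ℝ) {t : ℝ} (ht : 0 ≤ t) (g : L2Rn n) :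
    MemLp (fun ξ => (heatSymbol α t ξ : ℂ) * g ξ) 2 (volume : Measure (Rn n)) := by
  refine (Lp.memLp g).mono ?_ (Filter.Eventually.of_forall fun ξ => ?_)
  · refine AEStronglyMeasurable.mul ?_ (Lp.aestronglyMeasurable g)
    refine Measurable.aestronglyMeasurable ?_
    unfold heatSymbol
    fun_prop
  · rw [norm_mul, Complex.norm_real, Real.norm_eq_abs, heatSymbol, Real.abs_exp]
    refine mul_le_of_le_one_left (norm_nonneg _) (Real.exp_le_one_iff.2 ?_)
    have h : 0 ≤ (2 * Real.pi * ‖ξ‖) ^ (2 * α) := Real.rpow_nonneg (by positivity) _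
    nlinarith

/-- The fractional heat semigroup `e^{-t(-Δ)^α} f = 𝓕⁻¹(e^{-t|ξ|^{2α}} 𝓕 f)` on `L²(ℝⁿ)`, for
`t ≥ 0`, with the Fourier–Plancherel transform on `L²`. (The value for `t < 0` is a placeholder; all
times below are nonnegative.) -/
def fracHeat {n : ℕ} (α t : ℝ) (f : L2Rn n) : L2Rn n :=
  if ht : 0 ≤ t then 𝓕⁻ ((memLp_heatSymbol_mul α ht (𝓕 f)).toLp _) else 0

/-- `(q, p, r)` is `σ`-admissible: `1/q = σ(1/r - 1/p)`, `1 < r ≤ p ≤ ∞`, `σ > 0`. The exponent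
`∞` is allowed, with `1/∞ = 0`. -/
structure IsAdmissible (σ : ℝ) (q p r : ℝ≥0∞) : Prop where
  sigma_pos : 0 < σ
  q_pos : 0 < q
  one_lt_r : 1 < r
  r_le_p : r ≤ p
  scaling : (q⁻¹).toReal = σ * ((r⁻¹).toReal - (p⁻¹).toReal)

/-- The mixed norm `‖u‖_{L^q_t(I; L^p_x)}`, with values in `[0, ∞]`: the `L^q(I)` norm of
`t ↦ ‖u(t)‖_{L^p(ℝⁿ)}`. -/
def mixedNorm {n : ℕ} (q p : ℝ≥0∞) (I : Set ℝ) (u : ℝ → Rn n → ℂ) : ℝ≥0∞ :=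
  eLpNorm (fun t => eLpNorm (u t) p volume) q (volume.restrict I)

end

open Filter Topology

noncomputable section

/-! ### The inverse Fourier transform on `L²`, compared with the integral formula -/

section Fourier

variable {n : ℕ}

/-! Cut frequency space into shells where the symbol of `(-Δ)^α` is about `2^j`. A shell has volume
at most a constant times `2^{jn/(2α)}`, so by Bernstein (`eLpNorm_fourierInv_le_of_support`) and the
scaling relation its piece of the flow has `L^p` norm at most a constant times `2^{j/q} e^{-t 2^j}
a_j`, where `a_j` is the `L²` norm of `𝓕 f` on the shell (`eLpNorm_fracHeat_le_tsum`).

Summing over `j` maps `ℓ^q` to `L^q(0,∞)`: weighted Hölder, `∑ⱼ 2^{j/q} e^{-t 2^j} ≲ t^{-1/q}`, and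
a Gamma integral in `t` (`exists_lintegral_tsum_dyadic_rpow_le`). Finally `ℓ² ⊂ ℓ^q` for `q ≥ 2`,
and Plancherel bounds `∑ a_j²`. Neither duality nor real interpolation enters, so the endpoint `q =
2` is no harder. The case `q = ∞` forces `p = 2`, where the flow is a contraction. -/

theorem continuous_neg_innerₗ :
    Continuous fun p : Rn n × Rn n => (-innerₗ (Rn n)) p.1 p.2 :=
  (continuous_inner (𝕜 := ℝ)).neg

/-- Both sides give the same integral against every test function, since in both senses the inverse
transform can be moved onto a Schwartz function. -/
theorem fourierInv_toLp_ae_eq (g : L2Rn n) (hg : Integrable g volume) :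
    (𝓕⁻ g : L2Rn n) =ᵐ[volume] 𝓕⁻ (g : Rn n → ℂ) := by
  have hcont : Continuous (𝓕⁻ (g : Rn n → ℂ)) :=
    VectorFourier.fourierIntegral_continuous Real.continuous_fourierChar
      continuous_neg_innerₗ hg
  refine ae_eq_of_integral_contDiff_smul_eq
    ((Lp.memLp (𝓕⁻ g : L2Rn n)).locallyIntegrable (by norm_num)) hcont.locallyIntegrable ?_
  intro φ hφ hc
  let ψ : SchwartzMap (Rn n) ℂ := (hc.comp_left (g := fun r : ℝ => (r : ℂ)) (by simp)).toSchwartzMap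
    (Complex.ofRealCLM.contDiff.comp hφ)
  have hψ : ∀ x, ψ x = (φ x : ℂ) := fun x => rfl
  have h1 : ∫ x, ψ x • (𝓕⁻ g : L2Rn n) x = ∫ x, (𝓕⁻ ψ) x • g x := by
    have h := congrArg (fun T => T ψ) (Lp.fourierInv_toTemperedDistribution_eq g)
    simp only [TemperedDistribution.fourierInv_apply, Lp.toTemperedDistribution_apply] at h
    exact h.symm
  have h2 : ∫ x, (𝓕⁻ ψ) x • g x = ∫ x, ψ x • 𝓕⁻ (g : Rn n → ℂ) x := by
    rw [SchwartzMap.fourierInv_coe]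
    have h := VectorFourier.integral_fourierIntegral_smul_eq_flip (L := -innerₗ (Rn n))
      Real.continuous_fourierChar continuous_neg_innerₗ (ψ.integrable (μ := volume)) hg
    have hf : (-innerₗ (Rn n)).flip = -innerₗ (Rn n) := by
      ext x y; simp [real_inner_comm]
    rw [hf] at h
    exact h
  simpa [hψ] using h1.trans h2

theorem eLpNorm_top_fourierInv_le (g : L2Rn n) (hg : Integrable g volume) :
    eLpNorm (𝓕⁻ g : L2Rn n) ∞ volume ≤ eLpNorm g 1 volume := by
  rw [eLpNorm_congr_ae (fourierInv_toLp_ae_eq g hg), eLpNorm_exponent_top]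
  refine eLpNormEssSup_le_of_ae_enorm_bound (Eventually.of_forall fun x => ?_)
  rw [Real.fourierInv_eq, eLpNorm_one_eq_lintegral_enorm]
  refine (enorm_integral_le_lintegral_enorm _).trans (lintegral_mono fun y => ?_)
  rw [← ofReal_norm, Circle.norm_smul, ofReal_norm]

theorem eLpNorm_two_fourierInv (g : L2Rn n) :
    eLpNorm (𝓕⁻ g : L2Rn n) 2 volume = eLpNorm g 2 volume := by
  have h : ‖(𝓕⁻ g : L2Rn n)‖ = ‖g‖ := (Lp.fourierTransformₗᵢ (Rn n) ℂ).symm.norm_map g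
  rw [← Lp.enorm_def, ← Lp.enorm_def, ← ofReal_norm, ← ofReal_norm, h]

end Fourier

/-! ### Log-convexity of `L^p` norms between `2` and `∞` -/

section Interpolation

variable {X E : Type*} [MeasurableSpace X] {μ : Measure X} [NormedAddCommGroup E]

theorem eLpNorm_le_eLpNorm_two_rpow_mul_eLpNorm_top_rpow {f : X → E} {p : ℝ≥0∞}
    (hf : AEStronglyMeasurable f μ) (hp : 2 ≤ p) :
    eLpNorm f p μ ≤ eLpNorm f 2 μ ^ (2 * (p⁻¹).toReal) *
      eLpNorm f ∞ μ ^ (1 - 2 * (p⁻¹).toReal) := by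
  rcases eq_or_ne p ∞ with rfl | hp'
  · simp
  have hp2 : (2 : ℝ) ≤ p.toReal := by
    simpa using ENNReal.toReal_mono hp' hp
  have hp0 : p ≠ 0 := by rintro rfl; simp at hp
  set r := p.toReal with hr
  have hr0 : 0 < r := by linarith
  rw [eLpNorm_eq_lintegral_rpow_enorm_toReal hp0 hp', ENNReal.toReal_inv, ← hr,
    eLpNorm_eq_lintegral_rpow_enorm_toReal two_ne_zero ENNReal.ofNat_ne_top]
  simp only [ENNReal.toReal_ofNat]
  have key : ∫⁻ x, ‖f x‖ₑ ^ r ∂μ ≤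
      (∫⁻ x, ‖f x‖ₑ ^ (2 : ℝ) ∂μ) * eLpNorm f ∞ μ ^ (r - 2) := by
    calc ∫⁻ x, ‖f x‖ₑ ^ r ∂μ ≤ ∫⁻ x, eLpNorm f ∞ μ ^ (r - 2) * ‖f x‖ₑ ^ (2 : ℝ) ∂μ := by
          refine lintegral_mono_ae ?_
          filter_upwards [enorm_ae_le_eLpNormEssSup f μ] with x hx
          calc ‖f x‖ₑ ^ r = ‖f x‖ₑ ^ (r - 2) * ‖f x‖ₑ ^ (2 : ℝ) := by
                rw [← ENNReal.rpow_add_of_nonneg _ _ (by linarith) (by norm_num)]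
                congr 1; ring
            _ ≤ _ := by
                rw [← eLpNorm_exponent_top] at hx
                gcongr
      _ = _ := by
          rw [lintegral_const_mul'' _ (hf.enorm.pow_const _), mul_comm]
  calc (∫⁻ x, ‖f x‖ₑ ^ r ∂μ) ^ (1 / r)
      ≤ ((∫⁻ x, ‖f x‖ₑ ^ (2 : ℝ) ∂μ) * eLpNorm f ∞ μ ^ (r - 2)) ^ (1 / r) := by gcongr
    _ = _ := by
      rw [ENNReal.mul_rpow_of_nonneg _ _ (by positivity), ← ENNReal.rpow_mul, ← ENNReal.rpow_mul]
      congr 2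
      · field_simp
      · field_simp

end Interpolation

/-! ### Dominated convergence in `L²` -/

section Convergence

variable {X E : Type*} [MeasurableSpace X] {μ : Measure X} [NormedAddCommGroup E]

theorem tendsto_toLp_two_of_dominated {ι : Type*} {l : Filter ι} [l.IsCountablyGenerated]
    {F : ι → X → E} {f G : X → E} (hF : ∀ i, MemLp (F i) 2 μ) (hf : MemLp f 2 μ)
    (hG : MemLp G 2 μ) (hb : ∀ i, ∀ᵐ x ∂μ, ‖F i x‖ₑ ≤ ‖G x‖ₑ)
    (hlim : ∀ᵐ x ∂μ, Tendsto (fun i => F i x) l (𝓝 (f x))) :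
    Tendsto (fun i => (hF i).toLp (F i)) l (𝓝 (hf.toLp f)) := by
  rw [Lp.tendsto_Lp_iff_tendsto_eLpNorm'']
  simp only [eLpNorm_eq_lintegral_rpow_enorm_toReal two_ne_zero ENNReal.ofNat_ne_top,
    ENNReal.toReal_ofNat, Pi.sub_apply]
  have hH : MemLp (fun x => ‖G x‖ + ‖f x‖) 2 μ := hG.norm.add hf.norm
  have hfin := lintegral_rpow_enorm_lt_top_of_eLpNorm_lt_top two_ne_zero ENNReal.ofNat_ne_top hH.2
  have key : Tendsto (fun i => ∫⁻ x, ‖F i x - f x‖ₑ ^ (2 : ℝ) ∂μ) l (𝓝 (∫⁻ _, 0 ∂μ)) := by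
    refine tendsto_lintegral_filter_of_dominated_convergence'
      (fun x => ‖‖G x‖ + ‖f x‖‖ₑ ^ (2 : ℝ)) (Eventually.of_forall fun i => ?_)
      (Eventually.of_forall fun i => ?_) hfin.ne ?_
    · exact ((hF i).1.sub hf.1).enorm.pow_const _
    · filter_upwards [hb i] with x hx
      gcongr
      calc ‖F i x - f x‖ₑ ≤ ‖F i x‖ₑ + ‖f x‖ₑ := enorm_sub_le
        _ ≤ ‖G x‖ₑ + ‖f x‖ₑ := by gcongr
        _ = ‖‖G x‖ + ‖f x‖‖ₑ := by
          rw [Real.enorm_eq_ofReal (by positivity), ENNReal.ofReal_add (by positivity)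
            (by positivity), ofReal_norm, ofReal_norm]
    · filter_upwards [hlim] with x hx
      have h1 : Tendsto (fun i => ‖F i x - f x‖ₑ) l (𝓝 0) := by
        have := (hx.sub_const (f x)).enorm
        simpa using this
      simpa [Function.comp_def] using (ENNReal.continuous_rpow_const (y := 2)).tendsto 0 |>.comp h1
  simpa [Function.comp_def] using
    (ENNReal.continuous_rpow_const (y := 1 / 2)).tendsto _ |>.comp key

end Convergence

/-! ### Bernstein's inequality and its summed form -/

section Bernstein

variable {n : ℕ}

/-- **Bernstein's inequality** for frequencies in a set of finite measure. -/
theorem eLpNorm_fourierInv_le_of_support {g : L2Rn n} {S : Set (Rn n)}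
    (hS : volume S ≠ ∞) (hSm : MeasurableSet S) (hg : S.indicator g =ᵐ[volume] g) {p : ℝ≥0∞}
    (hp : 2 ≤ p) :
    eLpNorm (𝓕⁻ g : L2Rn n) p volume ≤
      volume S ^ (1 / 2 - (p⁻¹).toReal) * eLpNorm g 2 volume := by
  have h1 : eLpNorm g 1 volume ≤ eLpNorm g 2 volume * volume S ^ (1 / 2 : ℝ) := by
    rw [← eLpNorm_congr_ae hg, ← eLpNorm_congr_ae hg, eLpNorm_indicator_eq_eLpNorm_restrict hSm,
      eLpNorm_indicator_eq_eLpNorm_restrict hSm]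
    have h := eLpNorm_le_eLpNorm_mul_rpow_measure_univ (μ := volume.restrict S) (f := g)
      (p := 1) (q := 2) (by norm_num) (Lp.aestronglyMeasurable g).restrict
    refine h.trans_eq ?_
    norm_num
  have hint : Integrable g volume := by
    rw [← memLp_one_iff_integrable]
    refine ⟨Lp.aestronglyMeasurable g, h1.trans_lt (ENNReal.mul_lt_top (Lp.memLp g).2 ?_)⟩
    exact ENNReal.rpow_lt_top_of_nonneg (by norm_num) hS
  set θ := (p⁻¹).toReal with hθ
  have hθ2 : 2 * θ ≤ 1 := by
    have : θ ≤ ((2 : ℝ≥0∞)⁻¹).toReal := ENNReal.toReal_mono (by simp) (ENNReal.inv_le_inv.2 hp)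
    simp at this
    linarith
  have hθ0 : 0 ≤ θ := ENNReal.toReal_nonneg
  calc eLpNorm (𝓕⁻ g : L2Rn n) p volume
      ≤ eLpNorm (𝓕⁻ g : L2Rn n) 2 volume ^ (2 * θ) *
          eLpNorm (𝓕⁻ g : L2Rn n) ∞ volume ^ (1 - 2 * θ) :=
        eLpNorm_le_eLpNorm_two_rpow_mul_eLpNorm_top_rpow (Lp.aestronglyMeasurable _) hp
    _ ≤ eLpNorm g 2 volume ^ (2 * θ) *
          (eLpNorm g 2 volume * volume S ^ (1 / 2 : ℝ)) ^ (1 - 2 * θ) := by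
        rw [eLpNorm_two_fourierInv]
        have := (eLpNorm_top_fourierInv_le g hint).trans h1
        gcongr
    _ = _ := by
        rw [ENNReal.mul_rpow_of_nonneg _ _ (by linarith), ← mul_assoc,
          ← ENNReal.rpow_add_of_nonneg _ _ (by linarith) (by linarith), ← ENNReal.rpow_mul,
          show 2 * θ + (1 - 2 * θ) = 1 by ring, ENNReal.rpow_one, mul_comm]
        congr 2
        ring

/-- Finite partial sums obey the bound by Bernstein and the triangle inequality. They converge only
in `L²`, but that gives convergence in measure, under which `L^p` bounds survive. -/
theorem eLpNorm_fourierInv_le_tsum {ι : Type*} [Countable ι] {S : ι → Set (Rn n)}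
    (hSm : ∀ i, MeasurableSet (S i)) (hS : ∀ i, volume (S i) ≠ ∞)
    (hd : Pairwise (Function.onFun Disjoint S)) (hcov : ∀ᵐ x, ∃ i, x ∈ S i) (g : L2Rn n)
    {p : ℝ≥0∞} (hp : 2 ≤ p) :
    eLpNorm (𝓕⁻ g : L2Rn n) p volume ≤
      ∑' i, volume (S i) ^ (1 / 2 - (p⁻¹).toReal) * eLpNorm ((S i).indicator g) 2 volume := by
  classical
  have hmem : ∀ s : Finset ι, MemLp ((⋃ i ∈ s, S i).indicator g) 2 volume := fun s =>
    (Lp.memLp g).indicator (s.measurableSet_biUnion fun i _ => hSm i)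
  have hmemi : ∀ i, MemLp ((S i).indicator g) 2 volume := fun i => (Lp.memLp g).indicator (hSm i)
  let P : ι → L2Rn n := fun i => (hmemi i).toLp _
  let Q : Finset ι → L2Rn n := fun s => (hmem s).toLp _
  have hsum : ∀ s : Finset ι, Q s = ∑ i ∈ s, P i := by
    intro s
    refine Lp.ext ((hmem s).coeFn_toLp.trans ?_)
    refine EventuallyEq.trans ?_ (Lp.coeFn_finsetSum s P).symm
    have h : ∀ᵐ x, ∀ i : ι, P i x = (S i).indicator g x :=
      ae_all_iff.2 fun i => (hmemi i).coeFn_toLp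
    filter_upwards [h] with x hx
    rw [Finset.sum_apply, Finset.sum_congr rfl fun i _ => hx i, Finset.indicator_biUnion]
    exact fun i _ j _ hij => hd hij
  have hbern : ∀ i, eLpNorm (𝓕⁻ (P i) : L2Rn n) p volume ≤
      volume (S i) ^ (1 / 2 - (p⁻¹).toReal) * eLpNorm ((S i).indicator g) 2 volume := by
    intro i
    refine (eLpNorm_fourierInv_le_of_support (hS i) (hSm i) ?_ hp).trans_eq ?_
    · have hP : (P i : Rn n → ℂ) =ᵐ[volume] (S i).indicator g := (hmemi i).coeFn_toLp
      filter_upwards [hP] with x hx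
      by_cases hxS : x ∈ S i <;> simp [hx, hxS]
    · rw [eLpNorm_congr_ae (hmemi i).coeFn_toLp]
  have hpart : ∀ s : Finset ι, eLpNorm (𝓕⁻ (Q s) : L2Rn n) p volume ≤
      ∑' i, volume (S i) ^ (1 / 2 - (p⁻¹).toReal) * eLpNorm ((S i).indicator g) 2 volume := by
    intro s
    have h1 : (𝓕⁻ (Q s) : L2Rn n) = ∑ i ∈ s, 𝓕⁻ (P i) := by
      rw [hsum]
      exact map_sum (Lp.fourierTransformₗᵢ (Rn n) ℂ).symm _ _
    rw [h1, eLpNorm_congr_ae (Lp.coeFn_finsetSum _ _)]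
    refine (eLpNorm_sum_le (fun i _ => Lp.aestronglyMeasurable _)
      (one_le_two.trans hp)).trans ?_
    exact (Finset.sum_le_sum fun i _ => hbern i).trans (ENNReal.sum_le_tsum s)
  have hlim : Tendsto Q atTop (𝓝 ((Lp.memLp g).toLp g)) := by
    refine tendsto_toLp_two_of_dominated hmem (Lp.memLp g) (Lp.memLp g)
      (fun s => Eventually.of_forall fun x => enorm_indicator_le_enorm_self _ _) ?_
    filter_upwards [hcov] with x ⟨i, hi⟩
    refine tendsto_const_nhds.congr' ?_
    filter_upwards [eventually_ge_atTop {i}] with s hs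
    rw [indicator_of_mem]
    exact mem_iUnion₂.2 ⟨i, hs (Finset.mem_singleton_self i), hi⟩
  rw [Lp.toLp_coeFn] at hlim
  have hlim' := ((Lp.fourierTransformₗᵢ (Rn n) ℂ).symm.continuous.tendsto g).comp hlim
  exact eLpNorm_le_of_tendstoInMeasure (Eventually.of_forall hpart)
    (tendstoInMeasure_of_tendsto_Lp hlim') fun s => Lp.aestronglyMeasurable _

end Bernstein

/-! ### Lower semicontinuity of the `L^p` norm, for measurability in time -/

section Semicontinuity

variable {X E : Type*} [MeasurableSpace X] {μ : Measure X} [NormedAddCommGroup E]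

theorem lowerSemicontinuous_eLpNorm_Lp {r : ℝ≥0∞} [Fact (1 ≤ r)] (p : ℝ≥0∞) :
    LowerSemicontinuous fun f : Lp E r μ => eLpNorm f p μ := by
  rw [lowerSemicontinuous_iff_isClosed_preimage]
  intro c
  refine IsSeqClosed.isClosed fun u f hu huf => ?_
  exact eLpNorm_le_of_tendstoInMeasure (Eventually.of_forall hu)
    (tendstoInMeasure_of_tendsto_Lp huf) fun k => Lp.aestronglyMeasurable _

end Semicontinuity

/-! ### Dyadic exponential sums -/

section DyadicSums

theorem pairwise_disjoint_Ico_two_zpow :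
    Pairwise (Function.onFun Disjoint fun j : ℤ => Ico ((2 : ℝ) ^ j) (2 ^ (j + 1))) :=
  (zpow_right_mono₀ (one_le_two (α := ℝ))).pairwise_disjoint_on_Ico_succ

theorem lintegral_rpow_mul_exp_neg_mul_Ioi {s b : ℝ} (hs : 0 < s) (hb : 0 < b) :
    ∫⁻ x in Ioi (0 : ℝ), ENNReal.ofReal (x ^ (s - 1) * Real.exp (-(b * x))) =
      ENNReal.ofReal ((1 / b) ^ s * Real.Gamma s) := by
  have h := Real.integral_rpow_mul_exp_neg_mul_Ioi hs hb
  have hpos : 0 < (1 / b) ^ s * Real.Gamma s :=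
    mul_pos (Real.rpow_pos_of_pos (by positivity) _) (Real.Gamma_pos_of_pos hs)
  rw [← h, ofReal_integral_eq_lintegral_ofReal]
  · exact not_imp_comm.1 integral_undef (h ▸ hpos.ne')
  · filter_upwards [ae_restrict_mem measurableSet_Ioi] with x hx
    have : (0 : ℝ) < x := hx
    positivity

/-- Each term is dominated by an integral over its dyadic interval, and these add up to at most a
Gamma integral. -/
theorem tsum_zpow_rpow_mul_exp_le {s t : ℝ} (hs : 0 < s) (ht : 0 < t) :
    ∑' j : ℤ, ENNReal.ofReal (((2 : ℝ) ^ j) ^ s * Real.exp (-(t * 2 ^ j))) ≤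
      ENNReal.ofReal (2 * 2 ^ s * Real.Gamma s * t ^ (-s)) := by
  have hterm : ∀ j : ℤ, ENNReal.ofReal (((2 : ℝ) ^ j) ^ s * Real.exp (-(t * 2 ^ j))) ≤
      2 * ∫⁻ x in Ico ((2 : ℝ) ^ j) (2 ^ (j + 1)),
        ENNReal.ofReal (x ^ (s - 1) * Real.exp (-(t / 2 * x))) := by
    intro j
    set l : ℝ := 2 ^ j with hl
    have hl0 : 0 < l := by positivity
    have hl2 : (2 : ℝ) ^ (j + 1) = 2 * l := by rw [zpow_add_one₀ two_ne_zero, mul_comm]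
    rw [hl2]
    -- The halved rate `t / 2` absorbs `x < 2 * l` in the exponential; bounding `x ^ s` and `1 / x`
    -- separately works for either sign of `s - 1`.
    have hle : ∀ x ∈ Ico l (2 * l), l ^ s / (2 * l) * Real.exp (-(t * l)) ≤
        x ^ (s - 1) * Real.exp (-(t / 2 * x)) := by
      intro x hx
      have hx0 : 0 < x := hl0.trans_le hx.1
      rw [Real.rpow_sub_one hx0.ne']
      have := hx.1
      have := hx.2
      refine mul_le_mul ?_ (Real.exp_le_exp.2 (by nlinarith)) (by positivity) (by positivity)
      gcongr
    calc ENNReal.ofReal (l ^ s * Real.exp (-(t * l)))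
        = 2 * (ENNReal.ofReal (l ^ s / (2 * l) * Real.exp (-(t * l))) * volume (Ico l (2 * l))) := by
          rw [Real.volume_Ico, ← ENNReal.ofReal_mul (by positivity), ← ENNReal.ofReal_ofNat,
            ← ENNReal.ofReal_mul (by norm_num)]
          congr 1
          field_simp
          ring
      _ = 2 * ∫⁻ x in Ico l (2 * l), ENNReal.ofReal (l ^ s / (2 * l) * Real.exp (-(t * l))) := by
          rw [setLIntegral_const]
      _ ≤ _ := by
          gcongr 2 * ?_
          exact setLIntegral_mono' measurableSet_Ico fun x hx => ENNReal.ofReal_le_ofReal (hle x hx)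
  calc _ ≤ ∑' j : ℤ, 2 * ∫⁻ x in Ico ((2 : ℝ) ^ j) (2 ^ (j + 1)),
        ENNReal.ofReal (x ^ (s - 1) * Real.exp (-(t / 2 * x))) := ENNReal.tsum_le_tsum hterm
    _ = 2 * ∫⁻ x in ⋃ j : ℤ, Ico ((2 : ℝ) ^ j) (2 ^ (j + 1)),
        ENNReal.ofReal (x ^ (s - 1) * Real.exp (-(t / 2 * x))) := by
        rw [ENNReal.tsum_mul_left, lintegral_iUnion (fun j => measurableSet_Ico)
          pairwise_disjoint_Ico_two_zpow]
    _ ≤ 2 * ∫⁻ x in Ioi (0 : ℝ), ENNReal.ofReal (x ^ (s - 1) * Real.exp (-(t / 2 * x))) := by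
        gcongr 2 * ?_
        refine lintegral_mono_set (iUnion_subset fun j x hx => ?_)
        exact lt_of_lt_of_le (by positivity) hx.1
    _ = _ := by
        rw [lintegral_rpow_mul_exp_neg_mul_Ioi hs (by positivity), ← ENNReal.ofReal_ofNat,
          ← ENNReal.ofReal_mul (by norm_num)]
        congr 1
        rw [one_div_div, Real.div_rpow (by norm_num) ht.le, Real.rpow_neg ht.le]
        ring

/-- Hölder's inequality for the measure with weights `w`. -/
theorem tsum_mul_rpow_le {ι : Type*} {q : ℝ} (hq : 1 ≤ q) (w a : ι → ℝ≥0∞) :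
    (∑' i, w i * a i) ^ q ≤ (∑' i, w i) ^ (q - 1) * ∑' i, w i * a i ^ q := by
  have hq0 : 0 < q := by linarith
  have hqi : q⁻¹ ≤ 1 := inv_le_one_of_one_le₀ hq
  have h : ∑' i, w i * a i ≤ (∑' i, w i) ^ (1 - q⁻¹) * (∑' i, w i * a i ^ q) ^ q⁻¹ := by
    refine ENNReal.summable.tsum_le_of_sum_le fun s => ?_
    refine (ENNReal.inner_le_weight_mul_Lp_of_nonneg s hq w a).trans ?_
    have h1 := ENNReal.sum_le_tsum (f := w) s
    have h2 := ENNReal.sum_le_tsum (f := fun i => w i * a i ^ q) s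
    have h3 : 0 ≤ 1 - q⁻¹ := by linarith
    gcongr
  calc _ ≤ ((∑' i, w i) ^ (1 - q⁻¹) * (∑' i, w i * a i ^ q) ^ q⁻¹) ^ q := by gcongr
    _ = _ := by
      rw [ENNReal.mul_rpow_of_nonneg _ _ hq0.le, ← ENNReal.rpow_mul, ← ENNReal.rpow_mul,
        inv_mul_cancel₀ hq0.ne', ENNReal.rpow_one]
      congr 2
      field_simp

/-- The dyadic superposition `a ↦ ∑ⱼ 2^{j/q} e^{-t 2^j} aⱼ` is bounded from `ℓ^q` to `L^q(0,∞)`. -/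
theorem exists_lintegral_tsum_dyadic_rpow_le {q : ℝ} (hq : 1 ≤ q) :
    ∃ C : ℝ≥0, ∀ a : ℤ → ℝ≥0∞,
      ∫⁻ t in Ioi (0 : ℝ), (∑' j : ℤ,
        ENNReal.ofReal (((2 : ℝ) ^ j) ^ (1 / q) * Real.exp (-(t * 2 ^ j))) * a j) ^ q ≤
      C * ∑' j, a j ^ q := by
  have hq0 : 0 < q := by linarith
  set s := 1 / q with hs
  have hs0 : 0 < s := by positivity
  have hΓ := Real.Gamma_pos_of_pos hs0
  set K : ℝ := 2 * 2 ^ s * Real.Gamma s with hK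
  have hK0 : 0 < K := by positivity
  refine ⟨Real.toNNReal (K ^ (q - 1) * Real.Gamma s), fun a => ?_⟩
  have hpt : ∀ t ∈ Ioi (0 : ℝ), (∑' j : ℤ,
        ENNReal.ofReal (((2 : ℝ) ^ j) ^ s * Real.exp (-(t * 2 ^ j))) * a j) ^ q ≤
      ∑' j : ℤ, ENNReal.ofReal (K ^ (q - 1) * ((2 : ℝ) ^ j) ^ s) * a j ^ q *
        ENNReal.ofReal (t ^ (s - 1) * Real.exp (-(2 ^ j * t))) := by
    intro t ht
    have ht0 : 0 < t := ht
    refine (tsum_mul_rpow_le hq _ _).trans ?_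
    calc _ ≤ ENNReal.ofReal (K * t ^ (-s)) ^ (q - 1) * ∑' j : ℤ,
          ENNReal.ofReal (((2 : ℝ) ^ j) ^ s * Real.exp (-(t * 2 ^ j))) * a j ^ q := by
          have h1 := tsum_zpow_rpow_mul_exp_le hs0 ht0
          have h2 : 0 ≤ q - 1 := by linarith
          gcongr
      _ = _ := by
          rw [← ENNReal.tsum_mul_left]
          congr 1 with j
          -- Since `s * q = 1`, the power of `t` is `s - 1`, integrable at `0`; its Gamma integral
          -- gives `(2^j)^(-s)`, cancelling the weight `(2^j)^s`.
          rw [ENNReal.ofReal_rpow_of_pos (by positivity), Real.mul_rpow hK0.le (by positivity),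
            ← Real.rpow_mul ht0.le, show -s * (q - 1) = s - 1 by rw [hs]; field_simp; ring,
            ← mul_assoc, mul_right_comm _ (a j ^ q),
            ← ENNReal.ofReal_mul (by positivity), ← ENNReal.ofReal_mul (by positivity),
            mul_comm t]
          congr 2
          ring
  refine (setLIntegral_mono' measurableSet_Ioi hpt).trans ?_
  rw [lintegral_tsum fun j => by fun_prop, ← ENNReal.tsum_mul_left]
  refine (tsum_congr fun j => ?_).le
  have hl : (0 : ℝ) < 2 ^ j := by positivity
  rw [lintegral_const_mul _ (by fun_prop), lintegral_rpow_mul_exp_neg_mul_Ioi hs0 hl,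
    mul_right_comm, ← ENNReal.ofReal_mul (by positivity), ENNReal.ofReal]
  congr 3
  rw [Real.div_rpow zero_le_one hl.le, Real.one_rpow]
  field_simp

end DyadicSums

/-! ### Dyadic shells of the symbol -/

section Shells

variable {n : ℕ}

/-- The frequencies at which the symbol of `(-Δ)^α` lies in `[2^j, 2^(j+1))`. -/
def dyadicShell (n : ℕ) (α : ℝ) (j : ℤ) : Set (Rn n) :=
  (fun ξ : Rn n => (2 * Real.pi * ‖ξ‖) ^ (2 * α)) ⁻¹' Ico ((2 : ℝ) ^ j) (2 ^ (j + 1))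

theorem measurableSet_dyadicShell (α : ℝ) (j : ℤ) : MeasurableSet (dyadicShell n α j) :=
  measurableSet_preimage (by fun_prop) measurableSet_Ico

theorem pairwise_disjoint_dyadicShell (n : ℕ) (α : ℝ) :
    Pairwise (Function.onFun Disjoint (dyadicShell n α)) := fun _ _ hij =>
  (pairwise_disjoint_Ico_two_zpow hij).preimage _

theorem ae_exists_mem_dyadicShell (hn : 0 < n) (α : ℝ) :
    ∀ᵐ ξ : Rn n, ∃ j, ξ ∈ dyadicShell n α j := by
  have : Nonempty (Fin n) := ⟨⟨0, hn⟩⟩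
  filter_upwards [compl_mem_ae_iff.2 (measure_singleton (0 : Rn n))] with ξ hξ
  have h0 : 0 < ‖ξ‖ := norm_pos_iff.2 hξ
  have := Real.pi_pos
  exact exists_mem_Ico_zpow (Real.rpow_pos_of_pos (by positivity) _) one_lt_two

theorem volume_dyadicShell_le {α : ℝ} (hα : 0 < α) (hn : 0 < n) :
    ∃ B : ℝ≥0, ∀ j, volume (dyadicShell n α j) ≤
      B * ENNReal.ofReal (((2 : ℝ) ^ j) ^ ((n : ℝ) / (2 * α))) := by
  have : Nonempty (Fin n) := ⟨⟨0, hn⟩⟩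
  have hπ := Real.pi_pos
  -- Solving `(2π‖ξ‖)^(2α) ≤ 2 * 2^j` for `‖ξ‖` gives the radius `c * (2^j)^(1/(2α))`.
  set c : ℝ := 2 ^ (1 / (2 * α)) / (2 * Real.pi) with hc
  have hc0 : 0 < c := by positivity
  have hball : volume (Metric.ball (0 : Rn n) 1) ≠ ∞ := measure_ball_lt_top.ne
  refine ⟨Real.toNNReal (c ^ n) * (volume (Metric.ball (0 : Rn n) 1)).toNNReal, fun j => ?_⟩
  have hl : (0 : ℝ) < 2 ^ j := by positivity
  set l : ℝ := 2 ^ j with hldef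
  have hsub : dyadicShell n α j ⊆ Metric.closedBall 0 (c * l ^ (1 / (2 * α))) := by
    intro ξ hξ
    have h : (2 * Real.pi * ‖ξ‖) ^ (2 * α) ≤ 2 * l := by
      have := hξ.2.le
      rwa [zpow_add_one₀ two_ne_zero, mul_comm _ (2 : ℝ)] at this
    have h2 : 2 * Real.pi * ‖ξ‖ ≤ (2 * l) ^ (1 / (2 * α)) := by
      rw [one_div]
      exact (Real.le_rpow_inv_iff_of_pos (by positivity) (by positivity) (by positivity)).2 h
    rw [Real.mul_rpow (by norm_num) hl.le] at h2
    rw [mem_closedBall_zero_iff, hc, div_mul_eq_mul_div, le_div_iff₀ (by positivity)]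
    linarith
  refine (measure_mono hsub).trans_eq ?_
  rw [Measure.addHaar_closedBall _ _ (by positivity), finrank_euclideanSpace_fin, mul_pow,
    ← Real.rpow_mul_natCast hl.le, ENNReal.ofReal_mul (by positivity), ENNReal.coe_mul,
    ENNReal.coe_toNNReal hball, mul_right_comm, one_div_mul_eq_div]
  rfl

end Shells

/-! ### The semigroup: shell bound, measurability, Strichartz estimate -/

section FracHeat

variable {n : ℕ}

theorem eLpNorm_fracHeat_le_tsum {α : ℝ} (hα : 0 < α) (hn : 0 < n) {p : ℝ≥0∞} (hp : 2 ≤ p) {s : ℝ}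
    (hs : s = (n : ℝ) / (2 * α) * (1 / 2 - (p⁻¹).toReal)) :
    ∃ D : ℝ≥0, ∀ (t : ℝ), 0 ≤ t → ∀ f : L2Rn n,
      eLpNorm (fracHeat α t f) p volume ≤ D * ∑' j : ℤ,
        ENNReal.ofReal (((2 : ℝ) ^ j) ^ s * Real.exp (-(t * 2 ^ j))) *
          eLpNorm ((dyadicShell n α j).indicator (𝓕 f : L2Rn n)) 2 volume := by
  obtain ⟨B, hB⟩ := volume_dyadicShell_le hα hn
  set θ := 1 / 2 - (p⁻¹).toReal with hθ
  have hθ0 : 0 ≤ θ := by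
    have : (p⁻¹).toReal ≤ ((2 : ℝ≥0∞)⁻¹).toReal :=
      ENNReal.toReal_mono (by simp) (ENNReal.inv_le_inv.2 hp)
    rw [ENNReal.toReal_inv 2, ENNReal.toReal_ofNat] at this
    rw [hθ]
    linarith
  refine ⟨B ^ θ, fun t ht f => ?_⟩
  rw [fracHeat, dif_pos ht]
  refine (eLpNorm_fourierInv_le_tsum (measurableSet_dyadicShell α)
    (fun j => ((hB j).trans_lt (ENNReal.mul_lt_top ENNReal.coe_lt_top ENNReal.ofReal_lt_top)).ne)
    (pairwise_disjoint_dyadicShell n α) (ae_exists_mem_dyadicShell hn α) _ hp).trans ?_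
  rw [← ENNReal.tsum_mul_left]
  refine ENNReal.tsum_le_tsum fun j => ?_
  have hl : (0 : ℝ) < 2 ^ j := by positivity
  have hsymb : eLpNorm ((dyadicShell n α j).indicator
        ((memLp_heatSymbol_mul α ht (𝓕 f)).toLp _ : L2Rn n)) 2 volume ≤
      ENNReal.ofReal (Real.exp (-(t * 2 ^ j))) *
        eLpNorm ((dyadicShell n α j).indicator (𝓕 f : L2Rn n)) 2 volume := by
    refine eLpNorm_le_mul_eLpNorm_of_ae_le_mul ?_ 2
    filter_upwards [(memLp_heatSymbol_mul α ht (𝓕 f)).coeFn_toLp] with ξ hξ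
    by_cases hS : ξ ∈ dyadicShell n α j
    · rw [indicator_of_mem hS, indicator_of_mem hS, hξ, norm_mul, Complex.norm_real,
        Real.norm_eq_abs, heatSymbol, Real.abs_exp]
      gcongr
      have := hS.1
      nlinarith
    · simp [hS]
  calc _ ≤ (B * ENNReal.ofReal (((2 : ℝ) ^ j) ^ ((n : ℝ) / (2 * α)))) ^ θ *
        (ENNReal.ofReal (Real.exp (-(t * 2 ^ j))) *
          eLpNorm ((dyadicShell n α j).indicator (𝓕 f : L2Rn n)) 2 volume) := by
        gcongr
        exact hB j
    _ = _ := by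
        rw [ENNReal.mul_rpow_of_nonneg _ _ hθ0, ENNReal.ofReal_rpow_of_pos (by positivity),
          ← Real.rpow_mul hl.le, ← hs, ENNReal.ofReal_mul (by positivity),
          ENNReal.coe_rpow_of_nonneg _ hθ0]
        ring

/-- The case `q = 2` is additivity of the integral; for larger `q`, each extra factor is at most the
full norm to the power `q - 2`. -/
theorem tsum_eLpNorm_indicator_rpow_le {X E ι : Type*} [MeasurableSpace X] {μ : Measure X}
    [NormedAddCommGroup E] [Countable ι] {S : ι → Set X} (hSm : ∀ i, MeasurableSet (S i))
    (hd : Pairwise (Function.onFun Disjoint S)) (f : X → E) {q : ℝ} (hq : 2 ≤ q) :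
    ∑' i, eLpNorm ((S i).indicator f) 2 μ ^ q ≤ eLpNorm f 2 μ ^ q := by
  have hsq : ∀ i, eLpNorm ((S i).indicator f) 2 μ ^ (2 : ℝ) = ∫⁻ x in S i, ‖f x‖ₑ ^ (2 : ℝ) ∂μ := by
    intro i
    rw [eLpNorm_indicator_eq_eLpNorm_restrict (hSm i),
      eLpNorm_eq_lintegral_rpow_enorm_toReal two_ne_zero ENNReal.ofNat_ne_top, ← ENNReal.rpow_mul]
    simp
  have hsum : ∑' i, eLpNorm ((S i).indicator f) 2 μ ^ (2 : ℝ) ≤ eLpNorm f 2 μ ^ (2 : ℝ) := by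
    rw [tsum_congr hsq, ← lintegral_iUnion hSm hd,
      eLpNorm_eq_lintegral_rpow_enorm_toReal two_ne_zero ENNReal.ofNat_ne_top, ← ENNReal.rpow_mul]
    simpa using setLIntegral_le_lintegral (μ := μ) (⋃ i, S i) _
  have hsplit : ∀ x : ℝ≥0∞, x ^ q = x ^ (q - 2) * x ^ (2 : ℝ) := fun x => by
    rw [← ENNReal.rpow_add_of_nonneg _ _ (by linarith) (by norm_num), sub_add_cancel]
  have hq2 : 0 ≤ q - 2 := by linarith
  calc _ ≤ ∑' i, eLpNorm f 2 μ ^ (q - 2) * eLpNorm ((S i).indicator f) 2 μ ^ (2 : ℝ) := by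
        refine ENNReal.tsum_le_tsum fun i => ?_
        rw [hsplit]
        have := eLpNorm_indicator_le (p := 2) (μ := μ) (s := S i) f
        gcongr
    _ ≤ _ := by
        rw [ENNReal.tsum_mul_left, hsplit (eLpNorm f 2 μ)]
        gcongr

theorem eLpNorm_two_fourier (f : L2Rn n) :
    eLpNorm (𝓕 f : L2Rn n) 2 volume = eLpNorm f 2 volume := by
  rw [← eLpNorm_two_fourierInv, FourierTransform.fourierInv_fourier_eq]

theorem eLpNorm_two_fracHeat_le (α : ℝ) {t : ℝ} (ht : 0 ≤ t) (f : L2Rn n) :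
    eLpNorm (fracHeat α t f) 2 volume ≤ eLpNorm f 2 volume := by
  rw [fracHeat, dif_pos ht, eLpNorm_two_fourierInv, ← eLpNorm_two_fourier f,
    eLpNorm_congr_ae (memLp_heatSymbol_mul α ht (𝓕 f)).coeFn_toLp]
  refine eLpNorm_mono fun ξ => ?_
  rw [norm_mul, Complex.norm_real, Real.norm_eq_abs, heatSymbol, Real.abs_exp]
  refine mul_le_of_le_one_left (norm_nonneg _) (Real.exp_le_one_iff.2 ?_)
  have h : 0 ≤ (2 * Real.pi * ‖ξ‖) ^ (2 * α) := Real.rpow_nonneg (by positivity) _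
  nlinarith

/-- Clamping time at `0` avoids the jump to the placeholder value at negative times. -/
theorem continuous_fracHeat_max (α : ℝ) (f : L2Rn n) :
    Continuous fun t : ℝ => fracHeat α (max t 0) f := by
  have h0 : ∀ t : ℝ, 0 ≤ max t 0 := fun t => le_max_right _ _
  simp only [fracHeat, h0, dif_pos]
  refine (Lp.fourierTransformₗᵢ (Rn n) ℂ).symm.continuous.comp ?_
  refine continuous_iff_continuousAt.2 fun t => ?_
  refine tendsto_toLp_two_of_dominated (fun u => memLp_heatSymbol_mul α (h0 u) (𝓕 f))
    (memLp_heatSymbol_mul α (h0 t) (𝓕 f)) (Lp.memLp (𝓕 f))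
    (fun u => Eventually.of_forall fun ξ => ?_) (Eventually.of_forall fun ξ => ?_)
  · rw [enorm_le_iff_norm_le, norm_mul, Complex.norm_real, Real.norm_eq_abs, heatSymbol,
      Real.abs_exp]
    refine mul_le_of_le_one_left (norm_nonneg _) (Real.exp_le_one_iff.2 ?_)
    have h : 0 ≤ (2 * Real.pi * ‖ξ‖) ^ (2 * α) := Real.rpow_nonneg (by positivity) _
    have := h0 u
    nlinarith
  · have hc : Continuous fun u : ℝ => (heatSymbol α (max u 0) ξ : ℂ) * (𝓕 f : L2Rn n) ξ := by
      unfold heatSymbol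
      fun_prop
    exact hc.tendsto t

theorem aemeasurable_eLpNorm_fracHeat (α : ℝ) (p : ℝ≥0∞) (f : L2Rn n) :
    AEMeasurable (fun t : ℝ => eLpNorm (fracHeat α t f) p volume) (volume.restrict (Ici 0)) := by
  have h : Measurable fun t : ℝ => eLpNorm (fracHeat α (max t 0) f) p volume :=
    ((lowerSemicontinuous_eLpNorm_Lp p).comp (continuous_fracHeat_max α f)).measurable
  refine ⟨_, h, ?_⟩
  filter_upwards [ae_restrict_mem measurableSet_Ici] with t ht
  rw [max_eq_left ht]

/-- The homogeneous Strichartz estimate on the half-line, for a finite time exponent. -/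
theorem exists_mixedNorm_fracHeat_le {α : ℝ} (hα : 0 < α) (hn : 0 < n) {q p : ℝ≥0∞} (hp : 2 ≤ p)
    (hq : 2 ≤ q) (hqt : q ≠ ∞)
    (hs : (q⁻¹).toReal = (n : ℝ) / (2 * α) * (1 / 2 - (p⁻¹).toReal)) :
    ∃ C : ℝ≥0, ∀ f : L2Rn n,
      mixedNorm q p (Ici 0) (fun t => fracHeat α t f) ≤ C * eLpNorm f 2 volume := by
  have hq2 : (2 : ℝ) ≤ q.toReal := by simpa using ENNReal.toReal_mono hqt hq
  have hq0 : q ≠ 0 := by rintro rfl; simp at hq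
  set r := q.toReal with hr
  have hr0 : 0 < r := by linarith
  rw [ENNReal.toReal_inv, ← hr, ← one_div] at hs
  obtain ⟨D, hD⟩ := eLpNorm_fracHeat_le_tsum hα hn hp hs
  obtain ⟨C, hC⟩ := exists_lintegral_tsum_dyadic_rpow_le (q := r) (by linarith)
  refine ⟨D * C ^ (1 / r), fun f => ?_⟩
  set a : ℤ → ℝ≥0∞ := fun j =>
    eLpNorm ((dyadicShell n α j).indicator (𝓕 f : L2Rn n)) 2 volume with ha
  have ha_le : ∑' j, a j ^ r ≤ eLpNorm f 2 volume ^ r := by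
    rw [← eLpNorm_two_fourier]
    exact tsum_eLpNorm_indicator_rpow_le (measurableSet_dyadicShell α)
      (pairwise_disjoint_dyadicShell n α) _ hq2
  have hint : ∫⁻ t in Ici (0 : ℝ), eLpNorm (fracHeat α t f) p volume ^ r ≤
      (D : ℝ≥0∞) ^ r * (C * eLpNorm f 2 volume ^ r) := by
    -- The null time `t = 0` is dropped, as the dyadic bound is integrated over `t > 0`.
    rw [← restrict_Ioi_eq_restrict_Ici]
    calc _ ≤ ∫⁻ t in Ioi (0 : ℝ), (D : ℝ≥0∞) ^ r * (∑' j : ℤ,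
          ENNReal.ofReal (((2 : ℝ) ^ j) ^ (1 / r) * Real.exp (-(t * 2 ^ j))) * a j) ^ r := by
          refine setLIntegral_mono' measurableSet_Ioi fun t ht => ?_
          rw [← ENNReal.mul_rpow_of_nonneg _ _ hr0.le]
          exact ENNReal.rpow_le_rpow (hD t (le_of_lt ht) f) hr0.le
      _ ≤ _ := by
          rw [lintegral_const_mul' _ _ (ENNReal.rpow_ne_top_of_nonneg hr0.le ENNReal.coe_ne_top)]
          gcongr
          exact (hC a).trans (by gcongr)
  rw [mixedNorm, eLpNorm_eq_lintegral_rpow_enorm_toReal hq0 hqt]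
  simp only [enorm_eq_self, ← hr]
  refine (ENNReal.rpow_le_rpow hint (by positivity)).trans_eq ?_
  rw [ENNReal.mul_rpow_of_nonneg _ _ (by positivity), ENNReal.mul_rpow_of_nonneg _ _ (by positivity),
    ← ENNReal.rpow_mul, ← ENNReal.rpow_mul, mul_one_div_cancel hr0.ne', ENNReal.rpow_one,
    ENNReal.rpow_one, ENNReal.coe_mul, ENNReal.coe_rpow_of_nonneg _ (by positivity), mul_assoc]

end FracHeat

end

theorem proposition1p2 (n : ℕ) (α : ℝ) (hα : 0 < α) (q p : ℝ≥0∞)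
    (hadm : IsAdmissible ((n : ℝ) / (2 * α)) q p 2) (hq : 2 ≤ q)
    (hexc : ¬ (q = 2 ∧ p = ∞ ∧ (n : ℝ) / (2 * α) = 1)) :
    ∃ C : ℝ≥0, 0 < C ∧
      ∀ I : Set ℝ, (I = Ici 0 ∨ ∃ T : ℝ, 0 < T ∧ I = Icc 0 T) →
        ∀ f : L2Rn n,
          AEMeasurable (fun t : ℝ => eLpNorm (fracHeat α t f) p volume) (volume.restrict I) ∧
          mixedNorm q p I (fun t => fracHeat α t f) ≤ C * eLpNorm f 2 volume := by
  have hn : 0 < n := by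
    rcases Nat.eq_zero_or_pos n with rfl | h
    · simpa using hadm.sigma_pos
    · exact h
  have hhalf : ((2 : ℝ≥0∞)⁻¹).toReal = 1 / 2 := by simp
  have hscal := hadm.scaling
  rw [hhalf] at hscal
  have hmain : ∃ C : ℝ≥0, ∀ f : L2Rn n,
      mixedNorm q p (Ici 0) (fun t => fracHeat α t f) ≤ C * eLpNorm f 2 volume := by
    rcases eq_or_ne q ∞ with rfl | hqt
    · have hp : p = 2 := by
        have h : (p⁻¹).toReal = ((2 : ℝ≥0∞)⁻¹).toReal := by
          rw [hhalf]
          have := (mul_eq_zero.1 (hscal.symm.trans (by simp))).resolve_left hadm.sigma_pos.ne'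
          linarith
        have hp0 : p⁻¹ ≠ ∞ := by
          have := (zero_lt_one.trans hadm.one_lt_r).trans_le hadm.r_le_p
          simpa using this.ne'
        exact inv_injective ((ENNReal.toReal_eq_toReal_iff' hp0 (by simp)).1 h)
      subst hp
      refine ⟨1, fun f => ?_⟩
      rw [mixedNorm, eLpNorm_exponent_top, ENNReal.coe_one, one_mul]
      refine eLpNormEssSup_le_of_ae_enorm_bound ?_
      filter_upwards [ae_restrict_mem measurableSet_Ici] with t ht
      exact eLpNorm_two_fracHeat_le α ht f
    · exact exists_mixedNorm_fracHeat_le hα hn hadm.r_le_p hq hqt hscal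
  obtain ⟨C, hC⟩ := hmain
  -- Adding `1` makes the constant strictly positive.
  refine ⟨C + 1, by positivity, fun I hI f => ?_⟩
  have hsub : I ⊆ Ici 0 := by
    rcases hI with rfl | ⟨T, -, rfl⟩
    · exact subset_rfl
    · exact Icc_subset_Ici_self
  refine ⟨(aemeasurable_eLpNorm_fracHeat α p f).mono_set hsub, ?_⟩
  calc mixedNorm q p I (fun t => fracHeat α t f)
      ≤ mixedNorm q p (Ici 0) (fun t => fracHeat α t f) :=
        eLpNorm_mono_measure _ (Measure.restrict_mono hsub le_rfl)
    _ ≤ C * eLpNorm f 2 volume := hC f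
    _ ≤ _ := by
        gcongr
        simp
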